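/- Let $q\ge 3$ be an integer and $\lambda_q=2\cos(\pi/q)$. A Rosen continued fraction is a finite or infinite sequence of integers $b_1,b_2,\dots$, thought of as the expression $$b_1\lambda_q-\cfrac{1}{b_2\lambda_q-\cfrac{1}{b_3\lambda_q-\cdots}} .$$ Write $[b_1,\dots,b_n]_q\in\mathbb{R}\cup\{\infty\}$ for the value of the finite one with $n$ terms (with $1/0=\infty$, $1/\infty=0$, and value $\infty$ if $n=0$). A finite Rosen continued fraction $b_1,\dots,b_n$ is geodesic if every Rosen continued fraction with the same value has at least $n$ terms; an infinite one is geodesic if $b_1,\dots,b_m$ is geodesic for every $m\ge1$. The value of an infinite Rosen continued fraction is the limit of $[b_1,\dots,b_m]_q$ in $\mathbb{R}\cup\{\infty\}$ as $m\to\infty$, if it exists. The nearest-integer algorithm, applied to a real number $y$, starts with $t_0=y$. If $t_k=\infty$, it stops. If $t_k\in\mathbb{R}$, it outputs the integer $b_{k+1}$ for which $b_{k+1}\lambda_q$ is the integer multiple of $\lambda_q$ nearest to $t_k$ (the lesser one if there are two), and puts $t_{k+1}=s_{k+1}^{-1}(t_k)$, where $s_{k+1}(z)=b_{k+1}\lambda_q-1/z$.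 Theorem. For every integer $q\ge3$ and every real number $y$, the nearest-integer algorithm applied to $y$ produces a geodesic Rosen continued fraction with value $y$. It is finite if and only if $y$ is a vertex of the Farey graph $\mathcal{F}_q$, that is, $y$ lies in the orbit of $\infty$ under the Hecke group $G_q$ generated by the Möbius transformations $z\mapsto-1/z$ and $z\mapsto z+\lambda_q$. -/

import Mathlib

open Filter Topology
open scoped OnePoint MatrixGroups

noncomputable section

namespace Rosen

/-- `λ_q = 2 cos (π / q)`. -/
def lam (q : ℕ) : ℝ := 2 * Real.cos (Real.pi / q)

/-- The matrix of the Möbius transformation `σ(z) = -1 / z`. -/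
def sigma : GL (Fin 2) ℝ :=
  Matrix.GeneralLinearGroup.mkOfDetNeZero !![0, -1; 1, 0] (by simp)

/-- The matrix of the Möbius transformation `τ_q(z) = z + λ_q`. -/
def tau (q : ℕ) : GL (Fin 2) ℝ :=
  Matrix.GeneralLinearGroup.mkOfDetNeZero !![1, lam q; 0, 1] (by simp)

/-- The matrix group generated by `σ` and `τ_q`; the Hecke group `G_q` is the group of Möbius
transformations of `ℝ ∪ {∞}` that it induces. -/
def heckeGroup (q : ℕ) : Subgroup (GL (Fin 2) ℝ) := Subgroup.closure {sigma, tau q}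

/-- The vertices of the Farey graph `F_q`: the orbit of `∞` under `G_q` in `ℝ ∪ {∞}`. -/
def fareyVertices (q : ℕ) : Set (OnePoint ℝ) := MulAction.orbit (heckeGroup q) ∞

/-- The matrix of the Möbius transformation `z ↦ b λ_q - 1 / z`. -/
def rosenMap (q : ℕ) (b : ℤ) : GL (Fin 2) ℝ :=
  Matrix.GeneralLinearGroup.mkOfDetNeZero !![b * lam q, -1; 1, 0] (by simp)

theorem rosenMap_infty (q : ℕ) (b : ℤ) :
    rosenMap q b • (∞ : OnePoint ℝ) = ((b * lam q : ℝ) : OnePoint ℝ) := by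
  rw [OnePoint.smul_infty_eq_ite]
  simp [rosenMap, Matrix.GeneralLinearGroup.mkOfDetNeZero]

theorem rosenMap_zero (q : ℕ) (b : ℤ) :
    rosenMap q b • ((0 : ℝ) : OnePoint ℝ) = ∞ := by
  rw [OnePoint.smul_some_eq_ite]
  simp [rosenMap, Matrix.GeneralLinearGroup.mkOfDetNeZero]

theorem rosenMap_coe (q : ℕ) (b : ℤ) {x : ℝ} (hx : x ≠ 0) :
    rosenMap q b • (x : OnePoint ℝ) = ((b * lam q - 1 / x : ℝ) : OnePoint ℝ) := by
  rw [OnePoint.smul_some_eq_ite]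
  simp only [rosenMap, Matrix.GeneralLinearGroup.mkOfDetNeZero]
  simp [hx]
  field_simp
  ring

/-- The value in `ℝ ∪ {∞}` of the finite continued fraction
`[b₁, …, bₙ]_q = b₁ λ_q - 1 / (b₂ λ_q - 1 / (⋯ - 1 / (bₙ λ_q)))`,
with the convention that the empty continued fraction has value `∞`. -/
def value (q : ℕ) : List ℤ → OnePoint ℝ
  | [] => ∞
  | b :: l => rosenMap q b • value q l

/-- A Rosen continued fraction, finite or infinite, is given by its sequence of coefficients
`b₁, b₂, …`. This is the value of `[b₁, …, bₘ]_q`, its `m`-th convergent (for a finite sequence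
of fewer than `m` coefficients, the value of the whole continued fraction). -/
def convergent (q : ℕ) (c : Stream'.Seq ℤ) (m : ℕ) : OnePoint ℝ := value q (c.take m)

/-- The Rosen continued fraction `c` is an expansion of `x`: if `c` is finite, it evaluates
to `x`; if `c` is infinite, its convergents converge to `x` in `ℝ ∪ {∞}`. -/
def IsExpansion (q : ℕ) (c : Stream'.Seq ℤ) (x : OnePoint ℝ) : Prop :=
  (∀ h : c.Terminates, value q (c.toList h) = x) ∧
    (¬ c.Terminates → Tendsto (convergent q c) atTop (𝓝 x))

/-- A finite Rosen continued fraction is geodesic if no finite Rosen continued fraction with the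
same value has fewer terms. (Infinite ones cannot have fewer terms.) -/
def IsGeodesicFinite (q : ℕ) (l : List ℤ) : Prop :=
  ∀ l' : List ℤ, value q l' = value q l → l.length ≤ l'.length

/-- A geodesic Rosen continued fraction. An infinite one is geodesic if `[b₁, …, bₘ]_q` is
geodesic for all `m ≥ 1`. -/
def IsGeodesic (q : ℕ) (c : Stream'.Seq ℤ) : Prop :=
  (∀ h : c.Terminates, IsGeodesicFinite q (c.toList h)) ∧
    (¬ c.Terminates → ∀ m : ℕ, 1 ≤ m → IsGeodesicFinite q (c.take m))

/-- The integer `b` such that `b λ_q` is the integer multiple of `λ_q` nearest to `x`, where the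
lesser one is taken if there are two of them. -/
def nearest (q : ℕ) (x : ℝ) : ℤ := ⌈x / lam q - 1 / 2⌉

theorem lam_pos {q : ℕ} (hq : 3 ≤ q) : 0 < lam q := by
  have h3 : (3 : ℝ) ≤ q := by exact_mod_cast hq
  have hpi := Real.pi_pos
  have h1 : Real.pi / q < Real.pi / 2 := by
    apply div_lt_div_of_pos_left hpi <;> linarith
  have h0 : 0 < Real.pi / q := by positivity
  have := Real.cos_pos_of_mem_Ioo ⟨by linarith, h1⟩
  unfold lam
  linarith

theorem nearest_spec {q : ℕ} (hq : 3 ≤ q) (x : ℝ) (c : ℤ) :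
    |x - nearest q x * lam q| ≤ |x - c * lam q| ∧
      (|x - nearest q x * lam q| = |x - c * lam q| → nearest q x ≤ c) := by
  have hl := lam_pos hq
  obtain ⟨t, rfl⟩ : ∃ t, x = t * lam q := ⟨x / lam q, by field_simp⟩
  have hn : nearest q (t * lam q) = ⌈t - 1 / 2⌉ := by
    unfold nearest
    rw [mul_div_cancel_right₀ _ hl.ne']
  rw [hn]
  have h1 := Int.le_ceil (t - 1 / 2)
  have h2 := Int.ceil_lt_add_one (t - 1 / 2)
  generalize ⌈t - 1 / 2⌉ = b at *
  rw [← sub_mul, ← sub_mul, abs_mul, abs_mul, abs_of_pos hl]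
  have hb : |t - b| ≤ 1 / 2 := abs_le.2 ⟨by linarith, by linarith⟩
  rcases lt_trichotomy c b with h | h | h
  · have h' : (c : ℝ) + 1 ≤ b := by exact_mod_cast h
    have hlt : |t - b| < |t - c| :=
      lt_of_le_of_lt hb (lt_of_lt_of_le (by linarith) (le_abs_self _))
    have := mul_lt_mul_of_pos_right hlt hl
    exact ⟨this.le, fun e => absurd e this.ne⟩
  · subst h
    exact ⟨le_rfl, fun _ => le_rfl⟩
  · have h' : (b : ℝ) + 1 ≤ c := by exact_mod_cast h
    have hle : |t - b| ≤ |t - c| :=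
      hb.trans (le_trans (by linarith) (neg_le_abs _))
    exact ⟨mul_le_mul_of_nonneg_right hle hl.le, fun _ => h.le⟩

/-- The Rosen continued fraction that the nearest-integer algorithm produces from `y`. Its state
is initially `y`. In the state `∞` the algorithm stops; in a state `t ∈ ℝ` it outputs the
coefficient `b` for which `b λ_q` is nearest to `t` and passes to the state `s⁻¹(t)`, where
`s(z) = b λ_q - 1 / z`. Thus the state after `k` steps is `s_k⁻¹ ⋯ s_1⁻¹(y)`. -/
def nearestIntegerCF (q : ℕ) (y : ℝ) : Stream'.Seq ℤ :=
  Stream'.Seq.corec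
    (fun t : OnePoint ℝ =>
      t.elim none fun x : ℝ =>
        some (nearest q x, (rosenMap q (nearest q x))⁻¹ • (x : OnePoint ℝ)))
    (y : OnePoint ℝ)

end Rosen

end

/-!
Let `steps q t` be the number of steps that the nearest-integer algorithm takes from `t`. The heart
of the matter is that `steps q (-1 / t) ≤ steps q t + 1` for all `t` (`steps_sigma_le`). As the step
count is invariant under translation by `λ_q`, prepending a coefficient to a continued fraction
then raises the step count of its value by at most one. Hence a continued fraction of `n` terms has
a value with at most `n` steps, and the orbit of `∞` consists of points with finitely many steps.
This settles termination and the geodesic property of finite expansions.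

For the inequality, only `t` with `λ_q / 2 < |t| ≤ 2 / λ_q` needs work. For such positive `t` the
algorithm turns around an ideal `q`-gon of the Farey graph with vertices `∞, 0, 1 / λ_q, …, λ_q`:
from `t` it rotates forwards by the elliptic map `U(z) = 1 / (λ_q - z)`, and from `-1 / t`, up to a
translation, backwards, until both reach the edge of the polygon behind which `t` lies
(`exists_steps_add`). There one meets a pair `w`, `-1 / w` again, with smaller step counts, and the
inequality follows by induction. For even `q` both sides take the same number of rotations. For odd
`q` the numbers differ by one, depending on whether `t ≤ 1`, so the induction has to carry the
sharper inequality `steps q (-1 / t) ≤ steps q t ≤ steps q (-1 / t) + 1` for `t ≤ 1` and its mirror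
image for `t ≥ 1` (`odd_descent_aux`).

For infinite expansions one needs discreteness (`one_le_abs_of_mem`): up to sign and factors `σ`,
every element of the Hecke group is a product of matrices whose entries are `0` or at least `1`, so
a nonzero denominator is at least `1` in absolute value. If `a / c` is the `m`-th convergent of `y`,
then `|a - c y| ≤ (λ_q / 2) ^ m`, which gives convergence. Discreteness also shows that the
stabilizer of `∞` consists of the translations by multiples of `λ_q`. Together with the density of
the vertices this reduces the geodesic property of the convergents of `y` to that of nearby
vertices, whose expansions start with the same coefficients (`isGeodesicFinite_take`).
-/

namespace Rosen

/-! ### The algorithm as a map of `ℝ ∪ {∞}` -/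

/-- One step of the nearest-integer algorithm as a self-map of `ℝ ∪ {∞}`. The stopping state `∞`
is made a fixed point, so that the algorithm has stopped after `n` steps exactly when the `n`-th
iterate is `∞`. -/
noncomputable def gaussStep (q : ℕ) (t : OnePoint ℝ) : OnePoint ℝ :=
  t.elim ∞ fun x : ℝ => (rosenMap q (nearest q x))⁻¹ • (x : OnePoint ℝ)

/-- The number of steps that the nearest-integer algorithm takes from `t` until it stops; `⊤` if it
runs forever. It turns out to be the distance from `∞` to `t` in the Farey graph. -/
noncomputable def steps (q : ℕ) (t : OnePoint ℝ) : ℕ∞ :=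
  ⨅ (n : ℕ) (_ : (gaussStep q)^[n] t = ∞), (n : ℕ∞)

@[simp] theorem gaussStep_infty (q : ℕ) : gaussStep q ∞ = ∞ := rfl

theorem iterate_gaussStep_infty (q n : ℕ) : (gaussStep q)^[n] ∞ = ∞ :=
  Function.iterate_fixed (gaussStep_infty q) n

theorem steps_le_iff {q : ℕ} {t : OnePoint ℝ} {n : ℕ} :
    steps q t ≤ n ↔ (gaussStep q)^[n] t = ∞ := by
  constructor
  · intro h
    have h1 : steps q t < (n + 1 : ℕ) := lt_of_le_of_lt h (by exact_mod_cast n.lt_succ_self)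
    simp only [steps, iInf_lt_iff] at h1
    obtain ⟨m, hm, hmn⟩ := h1
    have hmn : m ≤ n := Nat.lt_succ_iff.1 (by exact_mod_cast hmn)
    obtain ⟨k, rfl⟩ := Nat.exists_eq_add_of_le' hmn
    rw [Function.iterate_add_apply, hm, iterate_gaussStep_infty]
  · intro h
    exact iInf₂_le n h

@[simp] theorem steps_infty (q : ℕ) : steps q ∞ = 0 :=
  nonpos_iff_eq_zero.1 (by exact_mod_cast (steps_le_iff (q := q) (n := 0)).2 rfl)

theorem steps_coe (q : ℕ) (x : ℝ) : steps q x = steps q (gaussStep q x) + 1 := by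
  have key : ∀ n : ℕ, steps q x ≤ n ↔ steps q (gaussStep q x) + 1 ≤ n := by
    rintro (_ | n)
    · rw [steps_le_iff]
      simp
    · rw [steps_le_iff, Function.iterate_succ_apply, ← steps_le_iff, Nat.cast_add_one,
        ENat.add_le_add_iff_right ENat.one_ne_top]
  generalize steps q x = a at key
  generalize steps q (gaussStep q x) + 1 = b at key
  refine le_antisymm ?_ ?_
  · cases b with
    | top => exact le_top
    | coe b => exact (key b).2 le_rfl
  · cases a with
    | top => exact le_top
    | coe a => exact (key a).1 le_rfl

theorem gaussStep_of_eq {q : ℕ} {x : ℝ} {b : ℤ} (hx : nearest q x = b) (h : b * lam q - x ≠ 0) :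
    gaussStep q x = ((1 / (b * lam q - x) : ℝ) : OnePoint ℝ) := by
  have : gaussStep q x = (rosenMap q b)⁻¹ • (x : OnePoint ℝ) := by rw [← hx]; rfl
  rw [this, inv_smul_eq_iff, rosenMap_coe _ _ (by positivity)]
  congr 1
  field_simp
  ring

theorem gaussStep_of_eq_zero {q : ℕ} {x : ℝ} {b : ℤ} (hx : nearest q x = b)
    (h : b * lam q - x = 0) : gaussStep q x = ∞ := by
  have : gaussStep q x = (rosenMap q b)⁻¹ • (x : OnePoint ℝ) := by rw [← hx]; rfl
  rw [this, inv_smul_eq_iff, rosenMap_infty]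
  congr 1
  linarith

theorem nearest_eq_iff {q : ℕ} (hq : 3 ≤ q) {x : ℝ} {b : ℤ} :
    nearest q x = b ↔ -(lam q / 2) ≤ b * lam q - x ∧ b * lam q - x < lam q / 2 := by
  have hl := lam_pos hq
  obtain ⟨t, rfl⟩ : ∃ t, x = t * lam q := ⟨x / lam q, by field_simp⟩
  unfold nearest
  rw [mul_div_cancel_right₀ _ hl.ne', Int.ceil_eq_iff]
  constructor
  · rintro ⟨h1, h2⟩
    constructor <;> nlinarith
  · rintro ⟨h1, h2⟩
    constructor <;> by_contra! h <;> nlinarith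

theorem gaussStep_add_lam {q : ℕ} (hq : 3 ≤ q) (x : ℝ) (k : ℤ) :
    gaussStep q ((x + k * lam q : ℝ)) = gaussStep q x := by
  have hn : nearest q (x + k * lam q) = nearest q x + k := by
    rw [nearest_eq_iff hq]
    have := (nearest_eq_iff hq).1 (rfl : nearest q x = _)
    push_cast
    constructor <;> linarith
  by_cases h : nearest q x * lam q - x = 0
  · rw [gaussStep_of_eq_zero rfl h, gaussStep_of_eq_zero hn (by push_cast; linarith)]
  · have e : ((nearest q x + k : ℤ) : ℝ) * lam q - (x + k * lam q) = nearest q x * lam q - x := by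
      push_cast; ring
    rw [gaussStep_of_eq rfl h, gaussStep_of_eq hn (by rwa [e]), e]

/-- The step count is invariant under the translations by multiples of `λ_q`. -/
theorem steps_add_lam {q : ℕ} (hq : 3 ≤ q) (x : ℝ) (k : ℤ) :
    steps q ((x + k * lam q : ℝ)) = steps q x := by
  rw [steps_coe, steps_coe, gaussStep_add_lam hq]

theorem sigma_eq (q : ℕ) : sigma = rosenMap q 0 := by
  ext i j
  fin_cases i <;> fin_cases j <;> simp [sigma, rosenMap, Matrix.GeneralLinearGroup.mkOfDetNeZero]

theorem sigma_infty : sigma • (∞ : OnePoint ℝ) = ((0 : ℝ) : OnePoint ℝ) := by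
  rw [sigma_eq 0, rosenMap_infty]; simp

theorem sigma_zero : sigma • ((0 : ℝ) : OnePoint ℝ) = ∞ := by
  rw [sigma_eq 0, rosenMap_zero]

theorem sigma_coe {x : ℝ} (hx : x ≠ 0) :
    sigma • (x : OnePoint ℝ) = ((-1 / x : ℝ) : OnePoint ℝ) := by
  rw [sigma_eq 0, rosenMap_coe _ _ hx]; congr 1; simp; ring

theorem sigma_sigma (x : OnePoint ℝ) : sigma • sigma • x = x := by
  induction x using OnePoint.rec with
  | infty => rw [sigma_infty, sigma_zero]
  | coe x =>
    by_cases hx : x = 0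
    · rw [hx, sigma_zero, sigma_infty]
    · rw [sigma_coe hx, sigma_coe (by positivity)]; congr 1; field_simp

theorem tau_eq (q : ℕ) (b : ℤ) : rosenMap q (b + 1) = tau q * rosenMap q b := by
  ext i j
  fin_cases i <;> fin_cases j <;> 
    simp [tau, rosenMap, Matrix.GeneralLinearGroup.mkOfDetNeZero, Matrix.mul_apply]
  ring

theorem tau_infty (q : ℕ) : tau q • (∞ : OnePoint ℝ) = ∞ := by
  rw [OnePoint.smul_infty_eq_ite]; simp [tau, Matrix.GeneralLinearGroup.mkOfDetNeZero]

theorem tau_coe (q : ℕ) (x : ℝ) : tau q • (x : OnePoint ℝ) = ((x + lam q : ℝ) : OnePoint ℝ) := by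
  rw [OnePoint.smul_some_eq_ite]; simp [tau, Matrix.GeneralLinearGroup.mkOfDetNeZero]

/-- By translation invariance, all the maps `z ↦ b λ_q - 1 / z` have the same effect on the step
count as `σ`. -/
theorem steps_rosenMap {q : ℕ} (hq : 3 ≤ q) (b : ℤ) (x : OnePoint ℝ) :
    steps q (rosenMap q b • x) = steps q (sigma • x) := by
  induction x using OnePoint.rec with
  | infty =>
    rw [sigma_infty, rosenMap_infty, ← steps_add_lam hq 0 b]; simp
  | coe x =>
    by_cases hx : x = 0
    · rw [hx, sigma_zero, rosenMap_zero]
    · rw [sigma_coe hx, rosenMap_coe _ _ hx, ← steps_add_lam hq (-1 / x) b]; congr 2; ring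

theorem steps_of_nearest_zero {q : ℕ} (hq : 3 ≤ q) {x : ℝ} (h1 : -(lam q / 2) < x)
    (h2 : x ≤ lam q / 2) : steps q x = steps q (sigma • (x : OnePoint ℝ)) + 1 := by
  rw [steps_coe]
  have hn : nearest q x = 0 := by rw [nearest_eq_iff hq]; constructor <;> push_cast <;> linarith
  congr 2
  by_cases h : x = 0
  · rw [gaussStep_of_eq_zero hn (by simp [h]), h, sigma_zero]
  · rw [gaussStep_of_eq hn (by simpa using h), sigma_coe h]; congr 1; simp; rw [neg_div, inv_eq_one_div]

/-! ### The rotation of order `q` -/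

/-- A parametrization of `ℝ ∪ {∞}`, `π`-periodic in `θ`, in which the elliptic map
`z ↦ 1 / (λ_q - z)` of order `q` becomes the rotation `θ ↦ θ + π / q`. The point `∞` is at the
multiples of `π`, `0` is at `π / q`, and `λ_q / 2` is at `π / 2`. -/
noncomputable def circlePt (q : ℕ) (θ : ℝ) : OnePoint ℝ :=
  if Real.sin θ = 0 then ∞ else ((Real.sin (θ - Real.pi / q) / Real.sin θ : ℝ) : OnePoint ℝ)

theorem circlePt_of_ne {q : ℕ} {θ : ℝ} (h : Real.sin θ ≠ 0) :
    circlePt q θ = ((Real.sin (θ - Real.pi / q) / Real.sin θ : ℝ) : OnePoint ℝ) := if_neg h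

theorem circlePt_of_eq {q : ℕ} {θ : ℝ} (h : Real.sin θ = 0) : circlePt q θ = ∞ := if_pos h

theorem circlePt_sub_pi (q : ℕ) (θ : ℝ) : circlePt q (θ - Real.pi) = circlePt q θ := by
  have e : Real.sin (θ - Real.pi - Real.pi / q) = - Real.sin (θ - Real.pi / q) := by
    rw [← Real.sin_sub_pi]; congr 1; ring
  by_cases h : Real.sin θ = 0
  · rw [circlePt_of_eq h, circlePt_of_eq (by rw [Real.sin_sub_pi, h, neg_zero])]
  · rw [circlePt_of_ne h, circlePt_of_ne (by rw [Real.sin_sub_pi]; exact neg_ne_zero.2 h), e,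
      Real.sin_sub_pi, neg_div_neg_eq]

theorem angle_bounds {q : ℕ} (hq : 3 ≤ q) : 0 < Real.pi / q ∧ Real.pi / q ≤ Real.pi / 3 := by
  have h3 : (3 : ℝ) ≤ q := by exact_mod_cast hq
  have hpi := Real.pi_pos
  refine ⟨by positivity, ?_⟩
  gcongr

theorem sin_angle_pos {q : ℕ} (hq : 3 ≤ q) : 0 < Real.sin (Real.pi / q) := by
  have := angle_bounds hq
  exact Real.sin_pos_of_pos_of_lt_pi this.1 (by linarith [Real.pi_pos])

theorem sin_add_angle (q : ℕ) (θ : ℝ) :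
    Real.sin (θ + Real.pi / q) = lam q * Real.sin θ - Real.sin (θ - Real.pi / q) := by
  rw [Real.sin_add, Real.sin_sub, lam]; ring

theorem sin_sub_angle_ne_zero {q : ℕ} (hq : 3 ≤ q) {θ : ℝ} (h : Real.sin θ = 0) :
    Real.sin (θ - Real.pi / q) ≠ 0 := by
  have hc : Real.cos θ ≠ 0 := by
    intro hc
    have := Real.sin_sq_add_cos_sq θ
    rw [h, hc] at this
    norm_num at this
  rw [Real.sin_sub, h, zero_mul, zero_sub]
  exact neg_ne_zero.2 (mul_ne_zero hc (sin_angle_pos hq).ne')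

theorem rosenMap_one_circlePt {q : ℕ} (hq : 3 ≤ q) (θ : ℝ) :
    rosenMap q 1 • circlePt q θ = circlePt q (θ - Real.pi / q) := by
  have key := sin_add_angle q (θ - Real.pi / q)
  rw [sub_add_cancel] at key
  by_cases h : Real.sin θ = 0
  · have h' := sin_sub_angle_ne_zero hq h
    rw [circlePt_of_eq h, circlePt_of_ne h', rosenMap_infty]
    congr 1
    rw [eq_div_iff h']
    push_cast
    linarith
  · by_cases h' : Real.sin (θ - Real.pi / q) = 0
    · rw [circlePt_of_ne h, circlePt_of_eq h', h', zero_div, rosenMap_zero]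
    · rw [circlePt_of_ne h, circlePt_of_ne h', rosenMap_coe _ _ (div_ne_zero h' h)]
      congr 1
      rw [one_div_div, Int.cast_one, one_mul, eq_div_iff h', sub_mul, div_mul_cancel₀ _ h']
      linarith

theorem steps_sigma_circlePt {q : ℕ} (hq : 3 ≤ q) (θ : ℝ) :
    steps q (sigma • circlePt q θ) = steps q (circlePt q (θ - Real.pi / q)) := by
  rw [← rosenMap_one_circlePt hq, steps_rosenMap hq]

/-- On `[0, λ_q / 2]` the nearest integer is `0`, and up to a translation the algorithm rotates
backwards. -/
theorem steps_circlePt_down {q : ℕ} (hq : 3 ≤ q) {θ : ℝ} (h1 : Real.pi / q ≤ θ)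
    (h2 : θ ≤ Real.pi / 2) :
    steps q (circlePt q θ) = steps q (circlePt q (θ - Real.pi / q)) + 1 := by
  have ha := angle_bounds hq
  have hpi := Real.pi_pos
  have hs : 0 < Real.sin θ := Real.sin_pos_of_pos_of_lt_pi (by linarith) (by linarith)
  have hl := lam_pos hq
  rw [← steps_sigma_circlePt hq, circlePt_of_ne hs.ne']
  apply steps_of_nearest_zero hq
  · have : 0 ≤ Real.sin (θ - Real.pi / q) :=
      Real.sin_nonneg_of_nonneg_of_le_pi (by linarith) (by linarith)
    have := div_nonneg this hs.le
    linarith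
  · have hc : 0 ≤ Real.cos θ := Real.cos_nonneg_of_mem_Icc ⟨by linarith, h2⟩
    have := mul_nonneg hc (sin_angle_pos hq).le
    rw [div_le_iff₀ hs, Real.sin_sub, lam]
    linarith

/-- On `(λ_q / 2, λ_q]` the nearest integer is `1`, and the algorithm rotates forwards. -/
theorem steps_circlePt_up {q : ℕ} (hq : 3 ≤ q) {θ : ℝ} (h1 : Real.pi / 2 < θ)
    (h2 : θ + Real.pi / q ≤ Real.pi) :
    steps q (circlePt q θ) = steps q (circlePt q (θ + Real.pi / q)) + 1 := by
  have ha := angle_bounds hq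
  have hpi := Real.pi_pos
  have hs : 0 < Real.sin θ := Real.sin_pos_of_pos_of_lt_pi (by linarith) (by linarith)
  have hl := lam_pos hq
  have hadd := sin_add_angle q θ
  have hc : Real.cos θ < 0 := Real.cos_neg_of_pi_div_two_lt_of_lt h1 (by linarith)
  have hs' : 0 ≤ Real.sin (θ + Real.pi / q) :=
    Real.sin_nonneg_of_nonneg_of_le_pi (by linarith) (by linarith)
  have e : lam q - Real.sin (θ - Real.pi / q) / Real.sin θ
      = Real.sin (θ + Real.pi / q) / Real.sin θ := by
    rw [hadd]; field_simp
  have hn : nearest q (Real.sin (θ - Real.pi / q) / Real.sin θ) = 1 := by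
    rw [nearest_eq_iff hq, Int.cast_one, one_mul, e]
    constructor
    · have := div_nonneg hs' hs.le
      linarith
    · have := mul_neg_of_neg_of_pos hc (sin_angle_pos hq)
      rw [div_lt_iff₀ hs, Real.sin_add, lam]
      linarith
  rw [circlePt_of_ne hs.ne', steps_coe]
  congr 2
  by_cases h : Real.sin (θ + Real.pi / q) = 0
  · rw [circlePt_of_eq h, gaussStep_of_eq_zero hn (by rw [Int.cast_one, one_mul, e, h, zero_div])]
  · rw [circlePt_of_ne h, add_sub_cancel_right, gaussStep_of_eq hn, Int.cast_one, one_mul, e,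
      one_div_div]
    rw [Int.cast_one, one_mul, e]
    exact div_ne_zero h hs.ne'

theorem steps_circlePt_down_iterate {q : ℕ} (hq : 3 ≤ q) (k : ℕ) {θ : ℝ}
    (h1 : k * (Real.pi / q) ≤ θ) (h2 : θ ≤ Real.pi / 2) :
    steps q (circlePt q θ) = steps q (circlePt q (θ - k * (Real.pi / q))) + k := by
  have ha := angle_bounds hq
  induction k generalizing θ with
  | zero => simp
  | succ k ih =>
    push_cast at h1 ⊢
    have hk : 0 ≤ k * (Real.pi / q) := mul_nonneg k.cast_nonneg ha.1.le
    rw [steps_circlePt_down hq (by linarith) h2, ih (by linarith) (by linarith), add_assoc]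
    congr 3
    ring

theorem steps_circlePt_up_iterate {q : ℕ} (hq : 3 ≤ q) (k : ℕ) {θ : ℝ}
    (h1 : Real.pi / 2 < θ) (h2 : θ + k * (Real.pi / q) ≤ Real.pi) :
    steps q (circlePt q θ) = steps q (circlePt q (θ + k * (Real.pi / q))) + k := by
  have ha := angle_bounds hq
  induction k generalizing θ with
  | zero => simp
  | succ k ih =>
    push_cast at h2 ⊢
    have hk : 0 ≤ k * (Real.pi / q) := mul_nonneg k.cast_nonneg ha.1.le
    rw [steps_circlePt_up hq h1 (by linarith), ih (by linarith) (by linarith), add_assoc]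
    congr 3
    ring

theorem exists_angle {q : ℕ} (hq : 3 ≤ q) (x : ℝ) :
    ∃ θ, 0 < θ ∧ θ < Real.pi ∧ x * Real.sin θ = Real.sin (θ - Real.pi / q) := by
  have hs := sin_angle_pos hq
  set t := Real.arctan ((x - Real.cos (Real.pi / q)) / Real.sin (Real.pi / q)) with ht
  have h1 := Real.neg_pi_div_two_lt_arctan ((x - Real.cos (Real.pi / q)) / Real.sin (Real.pi / q))
  have h2 := Real.arctan_lt_pi_div_two ((x - Real.cos (Real.pi / q)) / Real.sin (Real.pi / q))
  rw [← ht] at h1 h2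
  refine ⟨t + Real.pi / 2, by linarith, by linarith, ?_⟩
  have hc := Real.cos_pos_of_mem_Ioo ⟨h1, h2⟩
  have htan : Real.tan t = _ := Real.tan_arctan _
  rw [Real.tan_eq_sin_div_cos, div_eq_div_iff hc.ne' hs.ne'] at htan
  rw [Real.sin_sub, Real.sin_add_pi_div_two, Real.cos_add_pi_div_two]
  linarith

/-! ### Comparison of the step counts of `t` and `-1 / t` -/

/-- The arc `[0, 1]` of `ℝ ∪ {∞}`. -/
def lowerArc : Set (OnePoint ℝ) := {t | ∃ x : ℝ, 0 ≤ x ∧ x ≤ 1 ∧ t = x}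

/-- The arc `[1, ∞]` of `ℝ ∪ {∞}`. -/
def upperArc : Set (OnePoint ℝ) := {t | t = ∞ ∨ ∃ x : ℝ, 1 ≤ x ∧ t = x}

theorem sin_sub_add_sin_add (u v : ℝ) :
    Real.sin (u - v) + Real.sin (u + v) = 2 * Real.cos v * Real.sin u := by
  rw [Real.sin_sub, Real.sin_add]; ring

/-- From a point `x` of the interval `(λ_q / 2, 2 / λ_q]` the algorithm rotates forwards `j` times, and
from `-1 / x`, which is `x` rotated backwards once up to a translation, it rotates backwards `k`
times. As `j + k + 2 = q`, the two resulting points are one rotation apart, so that up to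
translations they are again of the form `w` and `-1 / w`. -/
theorem exists_steps_add {q : ℕ} (hq : 3 ≤ q) {θ : ℝ} (h1 : Real.pi / 2 < θ)
    (h2 : θ ≤ Real.pi / 2 + Real.pi / q) {j k : ℕ} (hjk : j + k + 2 = q)
    (hj : θ + j * (Real.pi / q) ≤ Real.pi) (hk : (k + 1) * (Real.pi / q) ≤ θ) :
    ∃ w ∈ lowerArc ∪ upperArc,
      steps q (circlePt q θ) = steps q w + j ∧
      steps q (sigma • circlePt q θ) = steps q (sigma • w) + k ∧
      (Real.pi ≤ θ + j * (Real.pi / q) + Real.pi / q / 2 → w ∈ upperArc) ∧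
      (θ + j * (Real.pi / q) + Real.pi / q / 2 ≤ Real.pi → w ∈ lowerArc) := by
  have ha := angle_bounds hq
  have hpi := Real.pi_pos
  have hpq : (j + k + 2) * (Real.pi / q) = Real.pi := by
    have : ((j + k + 2 : ℕ) : ℝ) = q := by exact_mod_cast hjk
    push_cast at this
    rw [this]
    field_simp
  have e1 := steps_circlePt_up_iterate hq j h1 hj
  have e2 := steps_circlePt_down_iterate hq k (θ := θ - Real.pi / q) (by linarith) (by linarith)
  rw [← steps_sigma_circlePt hq] at e2
  -- `φ` is reached by the forward rotations, and `φ + π / q - π` by the backward ones.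
  set φ := θ + j * (Real.pi / q) with hφ
  have hφ' : θ - Real.pi / q - k * (Real.pi / q) = φ + Real.pi / q - Real.pi := by
    rw [hφ]; linarith
  have hφ1 : Real.pi ≤ φ + Real.pi / q := by
    rw [hφ]; linarith
  rw [hφ', circlePt_sub_pi] at e2
  have hs : 0 ≤ Real.sin φ := Real.sin_nonneg_of_nonneg_of_le_pi (by linarith) hj
  have hs' : Real.sin (φ + Real.pi / q) ≤ 0 := by
    rw [← neg_nonneg, ← Real.sin_sub_pi]
    exact Real.sin_nonneg_of_nonneg_of_le_pi (by linarith) (by linarith)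
  have hsum : Real.sin φ + Real.sin (φ + Real.pi / q)
      = 2 * Real.cos (Real.pi / q / 2) * Real.sin (φ + Real.pi / q / 2) := by
    have e := sin_sub_add_sin_add (φ + Real.pi / q / 2) (Real.pi / q / 2)
    rwa [add_sub_cancel_right, add_assoc, add_halves] at e
  have hc : 0 < Real.cos (Real.pi / q / 2) :=
    Real.cos_pos_of_mem_Ioo ⟨by linarith, by linarith⟩
  have hupper : Real.pi ≤ φ + Real.pi / q / 2 → Real.sin φ ≤ -Real.sin (φ + Real.pi / q) := by
    intro h
    have : 0 ≤ Real.sin (φ + Real.pi / q / 2 - Real.pi) :=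
      Real.sin_nonneg_of_nonneg_of_le_pi (by linarith) (by linarith)
    rw [Real.sin_sub_pi] at this
    have := mul_nonneg hc.le this
    linarith
  have hlower : φ + Real.pi / q / 2 ≤ Real.pi → -Real.sin (φ + Real.pi / q) ≤ Real.sin φ := by
    intro h
    have : 0 ≤ Real.sin (φ + Real.pi / q / 2) :=
      Real.sin_nonneg_of_nonneg_of_le_pi (by linarith) (by linarith)
    have := mul_nonneg hc.le this
    linarith
  -- `σ` of the rotated point is the translate by `-λ_q` of the point at `φ`.
  refine ⟨sigma • circlePt q (φ + Real.pi / q), ?_⟩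
  rw [steps_sigma_circlePt hq, sigma_sigma, add_sub_cancel_right]
  suffices hloc : sigma • circlePt q (φ + Real.pi / q) ∈ lowerArc ∪ upperArc ∧
      (Real.pi ≤ φ + Real.pi / q / 2 → sigma • circlePt q (φ + Real.pi / q) ∈ upperArc) ∧
      (φ + Real.pi / q / 2 ≤ Real.pi → sigma • circlePt q (φ + Real.pi / q) ∈ lowerArc) from
    ⟨hloc.1, e1, e2, hloc.2⟩
  by_cases h' : Real.sin (φ + Real.pi / q) = 0
  · rw [circlePt_of_eq h', sigma_infty]
    have hs0 : Real.sin φ ≠ 0 := by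
      have := sin_sub_angle_ne_zero hq h'
      rwa [add_sub_cancel_right] at this
    have hl : ((0 : ℝ) : OnePoint ℝ) ∈ lowerArc := ⟨0, le_rfl, zero_le_one, rfl⟩
    refine ⟨Or.inl hl, fun h => ?_, fun _ => hl⟩
    have := hupper h
    rw [h', neg_zero] at this
    exact absurd (le_antisymm this hs) hs0
  · rw [circlePt_of_ne h', add_sub_cancel_right]
    by_cases h : Real.sin φ = 0
    · rw [h, zero_div, sigma_zero]
      have hu : ∞ ∈ upperArc := Or.inl rfl
      refine ⟨Or.inr hu, fun _ => hu, fun hh => ?_⟩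
      have := hlower hh
      rw [h] at this
      exact absurd (le_antisymm hs' (by linarith)) h'
    · have hs := lt_of_le_of_ne hs (Ne.symm h)
      rw [sigma_coe (div_ne_zero h h'), div_div_eq_mul_div, neg_one_mul]
      have hu : Real.pi ≤ φ + Real.pi / q / 2 →
          ((-Real.sin (φ + Real.pi / q) / Real.sin φ : ℝ) : OnePoint ℝ) ∈ upperArc := fun hh =>
        Or.inr ⟨_, (one_le_div hs).2 (hupper hh), rfl⟩
      have hl : φ + Real.pi / q / 2 ≤ Real.pi →
          ((-Real.sin (φ + Real.pi / q) / Real.sin φ : ℝ) : OnePoint ℝ) ∈ lowerArc := fun hh =>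
        ⟨_, div_nonneg (by linarith) hs.le, (div_le_one hs).2 (hlower hh), rfl⟩
      exact ⟨(le_total _ _).elim (fun hh => Or.inl (hl hh)) (fun hh => Or.inr (hu hh)), hu, hl⟩

theorem steps_of_lt {q : ℕ} (hq : 3 ≤ q) {x : ℝ} (hx : 2 / lam q < x) :
    steps q (sigma • (x : OnePoint ℝ)) = steps q x + 1 := by
  have hl := lam_pos hq
  have hx0 : 0 < x := lt_trans (by positivity) hx
  rw [sigma_coe hx0.ne', steps_of_nearest_zero hq, ← sigma_coe hx0.ne', sigma_sigma]
  · rw [lt_div_iff₀ hx0]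
    rw [div_lt_iff₀ hl] at hx
    linarith
  · have : -1 / x ≤ 0 := div_nonpos_of_nonpos_of_nonneg (by norm_num) hx0.le
    linarith

theorem lam_lt_two {q : ℕ} (hq : 3 ≤ q) : lam q < 2 := by
  have ha := angle_bounds hq
  have := Real.cos_lt_cos_of_nonneg_of_le_pi le_rfl (by linarith [Real.pi_pos]) ha.1
  rw [Real.cos_zero] at this
  unfold lam
  linarith

/-- The angles of the points of `(λ_q / 2, 2 / λ_q]`; the midpoint of the range of angles
corresponds to `1`. -/
theorem exists_angle_of_mem {q : ℕ} (hq : 3 ≤ q) {x : ℝ} (h1 : lam q / 2 < x)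
    (h2 : x ≤ 2 / lam q) : ∃ θ, circlePt q θ = x ∧ Real.pi / 2 < θ ∧
      θ ≤ Real.pi / 2 + Real.pi / q ∧ (x ≤ 1 → θ ≤ Real.pi / 2 + Real.pi / q / 2) ∧
      (1 ≤ x → Real.pi / 2 + Real.pi / q / 2 ≤ θ) := by
  have ha := angle_bounds hq
  have hpi := Real.pi_pos
  have hsa := sin_angle_pos hq
  have hl := lam_pos hq
  obtain ⟨θ, h0, hpi', hθ⟩ := exists_angle hq x
  have hs : 0 < Real.sin θ := Real.sin_pos_of_pos_of_lt_pi h0 hpi'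
  have hx : circlePt q θ = x := by
    rw [circlePt_of_ne hs.ne', ← hθ, mul_div_cancel_right₀ _ hs.ne']
  have hca : 0 < Real.cos (Real.pi / q / 2) :=
    Real.cos_pos_of_mem_Ioo ⟨by linarith, by linarith⟩
  have hsa2 : 0 < Real.sin (Real.pi / q / 2) :=
    Real.sin_pos_of_pos_of_lt_pi (by linarith) (by linarith)
  have hdiff : (x - 1) * Real.sin θ
      = -(2 * Real.sin (Real.pi / q / 2) * Real.cos (θ - Real.pi / q / 2)) := by
    have e3 : θ = (θ - Real.pi / q / 2) + Real.pi / q / 2 := by ring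
    have e4 : θ - Real.pi / q = (θ - Real.pi / q / 2) - Real.pi / q / 2 := by ring
    rw [sub_mul, hθ, one_mul, e4]
    conv_lhs => enter [2]; rw [e3]
    rw [Real.sin_sub _ (Real.pi / q / 2), Real.sin_add]
    ring
  refine ⟨θ, hx, ?_, ?_, ?_, ?_⟩
  · by_contra! h
    have hc : 0 ≤ Real.cos θ := Real.cos_nonneg_of_mem_Icc ⟨by linarith, h⟩
    have := mul_nonneg hc hsa.le
    have := mul_lt_mul_of_pos_right h1 hs
    rw [hθ, Real.sin_sub, lam] at this
    linarith
  · by_contra! h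
    have hc : Real.cos (θ - Real.pi / q) < 0 :=
      Real.cos_neg_of_pi_div_two_lt_of_lt (by linarith) (by linarith)
    have hc := mul_pos_of_neg_of_neg hc (neg_neg_of_pos hsa)
    rw [le_div_iff₀ hl, lam] at h2
    have := mul_le_mul_of_nonneg_right h2 hs.le
    have e : Real.sin θ = Real.sin ((θ - Real.pi / q) + Real.pi / q) := by congr 1; ring
    rw [Real.sin_add, ← hθ] at e
    nlinarith
  · intro hx1
    by_contra! h
    have hc : Real.cos (θ - Real.pi / q / 2) < 0 :=
      Real.cos_neg_of_pi_div_two_lt_of_lt (by linarith) (by linarith)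
    have := mul_pos_of_neg_of_neg hc (neg_neg_of_pos hsa2)
    have := mul_nonneg (sub_nonneg.2 hx1) hs.le
    linarith
  · intro hx1
    by_contra! h
    have hc : 0 < Real.cos (θ - Real.pi / q / 2) :=
      Real.cos_pos_of_mem_Ioo ⟨by linarith, by linarith⟩
    have := mul_pos hc hsa2
    have := mul_nonneg (sub_nonneg.2 hx1) hs.le
    linarith

/-- The induction behind the comparison for odd `q`, where `a t` and `b t` are the step counts of `t`
and `-1 / t`, and `A` and `B` are `[0, 1]` and `[1, ∞]`. Each descent moves between `A` and `B`; on
`B` it need not decrease `a` (for `q = 3`), so at each value of `a` the points of `A` are treated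
first. The hypotheses are symmetric under exchanging `a` with `b` and `A` with `B`, which yields the
reverse inequalities. -/
theorem odd_descent_aux {X : Type*} {A B : Set X} {a b : X → ℕ∞} {h : ℕ} (hh : 1 ≤ h)
    (hA : ∀ x ∈ A, a x = b x + 1 ∨ ∃ w ∈ B, a x = a w + h ∧ b x + 1 = b w + h)
    (hB : ∀ x ∈ B, b x = a x + 1 ∨ ∃ w ∈ A, b x = b w + h ∧ a x + 1 = a w + h) :
    (∀ x ∈ A, b x ≤ a x) ∧ ∀ x ∈ B, b x ≤ a x + 1 := by
  have key : ∀ n : ℕ, (∀ x ∈ A, a x = n → b x ≤ n) ∧ ∀ x ∈ B, a x = n → b x ≤ n + 1 := by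
    intro n
    induction n using Nat.strong_induction_on with
    | _ n ih =>
    have hA' : ∀ x ∈ A, a x = n → b x ≤ n := by
      intro x hx hn
      rcases hA x hx with h1 | ⟨w, hw, h1, h2⟩
      · rw [← hn, h1]
        exact le_self_add
      · rw [hn] at h1
        have hwt : a w ≠ ⊤ := fun ht => by rw [ht, top_add] at h1; exact ENat.natCast_ne_top _ h1
        obtain ⟨m, hm⟩ := ENat.ne_top_iff_exists.1 hwt
        rw [← hm] at h1
        have h1 : n = m + h := by exact_mod_cast h1
        have h3 := (ih m (by omega)).2 w hw hm.symm
        rw [← ENat.add_le_add_iff_right ENat.one_ne_top, h2]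
        calc b w + h ≤ m + 1 + h := by gcongr
          _ = n + 1 := by rw [h1]; push_cast; ring
    refine ⟨hA', fun x hx hn => ?_⟩
    rcases hB x hx with h1 | ⟨w, hw, h1, h2⟩
    · rw [h1, hn]
    · rw [hn] at h2
      have hwt : a w ≠ ⊤ := fun ht => by
        rw [ht, top_add] at h2; exact ENat.natCast_ne_top (n + 1) (by exact_mod_cast h2)
      obtain ⟨m, hm⟩ := ENat.ne_top_iff_exists.1 hwt
      rw [← hm] at h2
      have h2 : n + 1 = m + h := by exact_mod_cast h2
      have h3 : b w ≤ m := by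
        rcases (by omega : m ≤ n).eq_or_lt with e | e
        · subst e
          exact hA' w hw hm.symm
        · exact (ih m e).1 w hw hm.symm
      rw [h1]
      calc b w + h ≤ m + h := by gcongr
        _ = n + 1 := by exact_mod_cast h2.symm
  refine ⟨fun x hx => ?_, fun x hx => ?_⟩
  · by_cases ht : a x = ⊤
    · rw [ht]; exact le_top
    · obtain ⟨m, hm⟩ := ENat.ne_top_iff_exists.1 ht
      rw [← hm]
      exact (key m).1 x hx hm.symm
  · by_cases ht : a x = ⊤
    · rw [ht]; exact le_top
    · obtain ⟨m, hm⟩ := ENat.ne_top_iff_exists.1 ht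
      rw [← hm]
      exact (key m).2 x hx hm.symm

/-- The induction behind the comparison for even `q`; see `odd_descent_aux`. Here both step counts
decrease by the same amount. -/
theorem even_descent_aux {X : Type*} {A : Set X} {a b : X → ℕ∞} {h : ℕ} (hh : 1 ≤ h)
    (hA : ∀ x ∈ A, a x = b x + 1 ∨ b x = a x + 1 ∨ ∃ w ∈ A, a x = a w + h ∧ b x = b w + h) :
    ∀ x ∈ A, b x ≤ a x + 1 := by
  have key : ∀ n : ℕ, ∀ x ∈ A, a x = n → b x ≤ n + 1 := by
    intro n
    induction n using Nat.strong_induction_on with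
    | _ n ih =>
    intro x hx hn
    rcases hA x hx with h1 | h1 | ⟨w, hw, h1, h2⟩
    · rw [← hn, h1]
      exact le_self_add.trans le_self_add
    · rw [h1, hn]
    · rw [hn] at h1
      have hwt : a w ≠ ⊤ := fun ht => by rw [ht, top_add] at h1; exact ENat.natCast_ne_top _ h1
      obtain ⟨m, hm⟩ := ENat.ne_top_iff_exists.1 hwt
      rw [← hm] at h1
      have h1 : n = m + h := by exact_mod_cast h1
      have h3 := ih m (by omega) w hw hm.symm
      rw [h2]
      calc b w + h ≤ m + 1 + h := by gcongr
        _ = n + 1 := by rw [h1]; push_cast; ring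
  intro x hx
  by_cases ht : a x = ⊤
  · rw [ht]; exact le_top
  · obtain ⟨m, hm⟩ := ENat.ne_top_iff_exists.1 ht
    rw [← hm]
    exact key m x hx hm.symm

/-- The step counts of `t ∈ [0, ∞]` and of `-1 / t` differ by at most one. In the middle interval
`(λ_q / 2, 2 / λ_q]` both are traced by rotations: for even `q = 2h` there are `h - 1` on either side;
for odd `q = 2h + 1` there are `h` forwards and `h - 1` backwards if `t ≤ 1`, and conversely if
`1 ≤ t`. -/
theorem steps_sigma_of_mem_arc {q : ℕ} (hq : 3 ≤ q) {t : OnePoint ℝ}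
    (ht : t ∈ lowerArc ∪ upperArc) :
    steps q (sigma • t) ≤ steps q t + 1 ∧ steps q t ≤ steps q (sigma • t) + 1 := by
  have ha := angle_bounds hq
  have hl := lam_pos hq
  have hl2 := lam_lt_two hq
  have hpq : (q : ℝ) * (Real.pi / q) = Real.pi := by
    have : (q : ℝ) ≠ 0 := by positivity
    field_simp
  have h0 : steps q (0 : ℝ) = 1 := by
    rw [steps_of_nearest_zero hq (by linarith) (by linarith), sigma_zero, steps_infty, zero_add]
  have hlow : ∀ x : ℝ, 0 ≤ x → x ≤ lam q / 2 →
      steps q x = steps q (sigma • (x : OnePoint ℝ)) + 1 := fun x h1 h2 =>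
    steps_of_nearest_zero hq (by linarith) h2
  rcases q.even_or_odd' with ⟨h, he | ho⟩
  · have hq' : (2 * h : ℝ) * (Real.pi / q) = Real.pi := by
      have e : (q : ℝ) = 2 * h := by exact_mod_cast he
      rwa [← e]
    have hcast : ((h - 1 : ℕ) : ℝ) = h - 1 := by rw [Nat.cast_sub (by omega), Nat.cast_one]
    have key : ∀ t ∈ lowerArc ∪ upperArc, steps q t = steps q (sigma • t) + 1 ∨
        steps q (sigma • t) = steps q t + 1 ∨
        ∃ w ∈ lowerArc ∪ upperArc, steps q t = steps q w + (h - 1 : ℕ) ∧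
          steps q (sigma • t) = steps q (sigma • w) + (h - 1 : ℕ) := by
      have hmain : ∀ x : ℝ, 0 ≤ x → steps q x = steps q (sigma • (x : OnePoint ℝ)) + 1 ∨
          steps q (sigma • (x : OnePoint ℝ)) = steps q x + 1 ∨
          ∃ w ∈ lowerArc ∪ upperArc, steps q x = steps q w + (h - 1 : ℕ) ∧
            steps q (sigma • (x : OnePoint ℝ)) = steps q (sigma • w) + (h - 1 : ℕ) := by
        intro x hx
        rcases le_or_gt x (lam q / 2) with h1 | h1
        · exact Or.inl (hlow x hx h1)
        rcases lt_or_ge (2 / lam q) x with h2 | h2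
        · exact Or.inr (Or.inl (steps_of_lt hq h2))
        obtain ⟨θ, hθ, h3, h4, -⟩ := exists_angle_of_mem hq h1 h2
        obtain ⟨w, hw, h5, h6, -⟩ := exists_steps_add hq h3 h4 (j := h - 1) (k := h - 1)
          (by omega) (by rw [hcast]; linarith) (by rw [hcast]; linarith)
        rw [hθ] at h5 h6
        exact Or.inr (Or.inr ⟨w, hw, h5, h6⟩)
      rintro t (⟨x, hx, -, rfl⟩ | rfl | ⟨x, hx, rfl⟩)
      · exact hmain x hx
      · right; left
        rw [sigma_infty, h0, steps_infty, zero_add]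
      · exact hmain x (by linarith)
    refine ⟨even_descent_aux (by omega) key t ht,
      even_descent_aux (a := fun t => steps q (sigma • t)) (b := steps q) (h := h - 1) (by omega)
        (fun x hx => ?_) t ht⟩
    rcases key x hx with h1 | h1 | ⟨w, hw, h1, h2⟩
    · exact Or.inr (Or.inl h1)
    · exact Or.inl h1
    · exact Or.inr (Or.inr ⟨w, hw, h2, h1⟩)
  · have hq' : (2 * h + 1 : ℝ) * (Real.pi / q) = Real.pi := by
      have e : (q : ℝ) = 2 * h + 1 := by exact_mod_cast ho
      rwa [← e]
    have hcast : ((h - 1 : ℕ) : ℝ) = h - 1 := by rw [Nat.cast_sub (by omega), Nat.cast_one]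
    have hcast' : ((h - 1 : ℕ) : ℕ∞) + 1 = h := by
      have : h - 1 + 1 = h := by omega
      exact_mod_cast this
    have keyA : ∀ t ∈ lowerArc, steps q t = steps q (sigma • t) + 1 ∨
        ∃ w ∈ upperArc, steps q t = steps q w + h ∧
          steps q (sigma • t) + 1 = steps q (sigma • w) + h := by
      rintro t ⟨x, hx, hx1, rfl⟩
      rcases le_or_gt x (lam q / 2) with h1 | h1
      · exact Or.inl (hlow x hx h1)
      have h2 : x ≤ 2 / lam q := by rw [le_div_iff₀ hl]; nlinarith
      obtain ⟨θ, hθ, h3, h4, h5, -⟩ := exists_angle_of_mem hq h1 h2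
      have h5 := h5 hx1
      obtain ⟨w, -, h6, h7, h8, -⟩ := exists_steps_add hq h3 h4 (j := h) (k := h - 1)
        (by omega) (by linarith) (by rw [hcast]; linarith)
      rw [hθ] at h6 h7
      refine Or.inr ⟨w, h8 (by linarith), h6, ?_⟩
      rw [h7, add_assoc, hcast']
    have keyB : ∀ t ∈ upperArc, steps q (sigma • t) = steps q t + 1 ∨
        ∃ w ∈ lowerArc, steps q (sigma • t) = steps q (sigma • w) + h ∧
          steps q t + 1 = steps q w + h := by
      rintro t (rfl | ⟨x, hx1, rfl⟩)
      · left
        rw [sigma_infty, h0, steps_infty, zero_add]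
      rcases lt_or_ge (2 / lam q) x with h2 | h2
      · exact Or.inl (steps_of_lt hq h2)
      have h1 : lam q / 2 < x := by linarith
      obtain ⟨θ, hθ, h3, h4, -, h5⟩ := exists_angle_of_mem hq h1 h2
      have h5 := h5 hx1
      obtain ⟨w, -, h6, h7, -, h8⟩ := exists_steps_add hq h3 h4 (j := h - 1) (k := h)
        (by omega) (by rw [hcast]; linarith) (by linarith)
      rw [hθ] at h6 h7
      refine Or.inr ⟨w, h8 (by rw [hcast]; linarith), h7, ?_⟩
      rw [h6, add_assoc, hcast']
    have h1 := odd_descent_aux (by omega) keyA keyB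
    have h2 := odd_descent_aux (b := steps q) (by omega) keyB keyA
    rcases ht with ht | ht
    · exact ⟨(h1.1 t ht).trans le_self_add, h2.2 t ht⟩
    · exact ⟨h1.2 t ht, (h2.1 t ht).trans le_self_add⟩

/-- The key estimate: `σ` raises the step count by at most one. For negative `t` it is the reverse
inequality of `steps_sigma_of_mem_arc` at `-1 / t`. -/
theorem steps_sigma_le {q : ℕ} (hq : 3 ≤ q) (t : OnePoint ℝ) :
    steps q (sigma • t) ≤ steps q t + 1 := by
  have key : ∀ x : ℝ, 0 ≤ x → (x : OnePoint ℝ) ∈ lowerArc ∪ upperArc := fun x hx =>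
    (le_total x 1).elim (fun h => Or.inl ⟨x, hx, h, rfl⟩) (fun h => Or.inr (Or.inr ⟨x, h, rfl⟩))
  induction t using OnePoint.rec with
  | infty => exact (steps_sigma_of_mem_arc hq (Or.inr (Or.inl rfl))).1
  | coe x =>
    rcases le_or_gt 0 x with hx | hx
    · exact (steps_sigma_of_mem_arc hq (key x hx)).1
    · have h := (steps_sigma_of_mem_arc hq (key (-1 / x)
        (div_nonneg_of_nonpos (by norm_num) hx.le))).2
      rwa [← sigma_coe hx.ne, sigma_sigma] at h

theorem steps_rosenMap_le {q : ℕ} (hq : 3 ≤ q) (b : ℤ) (t : OnePoint ℝ) :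
    steps q (rosenMap q b • t) ≤ steps q t + 1 := by
  rw [steps_rosenMap hq]
  exact steps_sigma_le hq t

/-! ### The matrix of a finite continued fraction -/

/-- The product of the matrices of the maps `z ↦ b_i λ_q - 1 / z`. It takes `∞` to the value of the
continued fraction. -/
noncomputable def cfMatrix (q : ℕ) (l : List ℤ) : GL (Fin 2) ℝ := (l.map (rosenMap q)).prod

@[simp] theorem cfMatrix_nil (q : ℕ) : cfMatrix q [] = 1 := rfl

@[simp] theorem cfMatrix_cons (q : ℕ) (b : ℤ) (l : List ℤ) :
    cfMatrix q (b :: l) = rosenMap q b * cfMatrix q l := by simp [cfMatrix]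

theorem value_eq_smul (q : ℕ) (l : List ℤ) : value q l = cfMatrix q l • (∞ : OnePoint ℝ) := by
  induction l with
  | nil => simp [value]
  | cons b l ih => rw [value, ih, cfMatrix_cons, mul_smul]

theorem steps_cfMatrix_smul_le {q : ℕ} (hq : 3 ≤ q) (l : List ℤ) (t : OnePoint ℝ) :
    steps q (cfMatrix q l • t) ≤ steps q t + l.length := by
  induction l with
  | nil => simp
  | cons b l ih =>
    rw [cfMatrix_cons, mul_smul, List.length_cons, Nat.cast_add_one, ← add_assoc]
    exact (steps_rosenMap_le hq b _).trans (by gcongr)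

/-- No continued fraction is shorter than what the algorithm produces from its value. -/
theorem steps_value_le {q : ℕ} (hq : 3 ≤ q) (l : List ℤ) : steps q (value q l) ≤ l.length := by
  simpa [value_eq_smul] using steps_cfMatrix_smul_le hq l ∞

theorem sigma_mem (q : ℕ) : sigma ∈ heckeGroup q := Subgroup.subset_closure (Or.inl rfl)

theorem tau_mem (q : ℕ) : tau q ∈ heckeGroup q := Subgroup.subset_closure (Or.inr rfl)

theorem rosenMap_mem (q : ℕ) (b : ℤ) : rosenMap q b ∈ heckeGroup q := by
  induction b using Int.induction_on with
  | zero => rw [← sigma_eq q]; exact sigma_mem q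
  | succ n ih => rw [tau_eq]; exact mul_mem (tau_mem q) ih
  | pred n ih =>
    have h := tau_eq q (-(n : ℤ) - 1)
    rw [sub_add_cancel] at h
    rw [h] at ih
    exact (Subgroup.mul_mem_cancel_left _ (tau_mem q)).1 ih

theorem cfMatrix_mem (q : ℕ) (l : List ℤ) : cfMatrix q l ∈ heckeGroup q := by
  induction l with
  | nil => exact one_mem _
  | cons b l ih => rw [cfMatrix_cons]; exact mul_mem (rosenMap_mem q b) ih

theorem steps_smul_ne_top {q : ℕ} (hq : 3 ≤ q) {g : GL (Fin 2) ℝ} (hg : g ∈ heckeGroup q)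
    (t : OnePoint ℝ) : steps q (g • t) ≠ ⊤ ↔ steps q t ≠ ⊤ := by
  induction hg using Subgroup.closure_induction generalizing t with
  | mem g hg =>
    rcases hg with rfl | rfl
    · have key : ∀ t, steps q t ≠ ⊤ → steps q (sigma • t) ≠ ⊤ := fun t ht =>
        ne_top_of_le_ne_top (by simpa using ht) (steps_sigma_le hq t)
      exact ⟨fun h => by simpa [sigma_sigma] using key _ h, key t⟩
    · induction t using OnePoint.rec with
      | infty => rw [tau_infty]
      | coe x =>
        have := steps_add_lam hq x 1
        rw [Int.cast_one, one_mul] at this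
        rw [tau_coe, this]
  | one => simp
  | mul g h _ _ ihg ihh => rw [mul_smul, ihg, ihh]
  | inv g _ ih => rw [← ih, smul_inv_smul]

/-! ### The sequence of coefficients -/

/-- The coefficients that the algorithm produces from an arbitrary state in `ℝ ∪ {∞}`. Unlike
`nearestIntegerCF` it may be started at the state that is reached after one step. -/
noncomputable def nicf (q : ℕ) (t : OnePoint ℝ) : Stream'.Seq ℤ :=
  Stream'.Seq.corec
    (fun t : OnePoint ℝ =>
      t.elim none fun x : ℝ =>
        some (nearest q x, (rosenMap q (nearest q x))⁻¹ • (x : OnePoint ℝ))) t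

theorem nicf_infty (q : ℕ) : nicf q ∞ = Stream'.Seq.nil := Stream'.Seq.corec_nil _ _ rfl

theorem nicf_coe (q : ℕ) (x : ℝ) :
    nicf q x = Stream'.Seq.cons (nearest q x) (nicf q (gaussStep q x)) :=
  Stream'.Seq.corec_cons rfl

theorem nicf_terminatedAt (q n : ℕ) (t : OnePoint ℝ) :
    (nicf q t).TerminatedAt n ↔ (gaussStep q)^[n] t = ∞ := by
  induction n generalizing t with
  | zero =>
    induction t using OnePoint.rec with
    | infty => simp [nicf_infty, Stream'.Seq.terminatedAt_nil]
    | coe x => simp [nicf_coe, Stream'.Seq.cons_not_terminatedAt_zero]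
  | succ n ih =>
    induction t using OnePoint.rec with
    | infty => simp [nicf_infty, Stream'.Seq.terminatedAt_nil, iterate_gaussStep_infty]
    | coe x => rw [nicf_coe, Stream'.Seq.cons_terminatedAt_succ_iff, ih, Function.iterate_succ_apply]

theorem nicf_terminates (q : ℕ) (t : OnePoint ℝ) : (nicf q t).Terminates ↔ steps q t ≠ ⊤ := by
  constructor
  · rintro ⟨n, hn⟩
    exact ne_top_of_le_ne_top (ENat.natCast_ne_top n)
      (steps_le_iff.2 ((nicf_terminatedAt q n t).1 hn))
  · intro h
    obtain ⟨n, hn⟩ := ENat.ne_top_iff_exists.1 h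
    exact ⟨n, (nicf_terminatedAt q n t).2 (steps_le_iff.1 hn.symm.le)⟩

theorem cfMatrix_take_succ (q n : ℕ) (x : ℝ) : cfMatrix q ((nicf q x).take (n + 1)) =
    rosenMap q (nearest q x) * cfMatrix q ((nicf q (gaussStep q x)).take n) := by
  rw [nicf_coe, Stream'.Seq.take_succ_cons, cfMatrix_cons]

theorem cfMatrix_take_smul (q n : ℕ) (t : OnePoint ℝ) :
    cfMatrix q ((nicf q t).take n) • (gaussStep q)^[n] t = t := by
  induction n generalizing t with
  | zero => simp
  | succ n ih =>
    induction t using OnePoint.rec with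
    | infty => simp [nicf_infty, iterate_gaussStep_infty]
    | coe x =>
      rw [cfMatrix_take_succ, Function.iterate_succ_apply, mul_smul, ih]
      exact smul_inv_smul _ _

theorem value_toList_nicf (q : ℕ) (t : OnePoint ℝ) (h : (nicf q t).Terminates) :
    value q ((nicf q t).toList h) = t := by
  have h1 : (gaussStep q)^[(nicf q t).length h] t = ∞ :=
    (nicf_terminatedAt q _ t).1 (Nat.find_spec h)
  have h2 := cfMatrix_take_smul q ((nicf q t).length h) t
  rw [h1, ← value_eq_smul] at h2
  exact h2

theorem length_toList_nicf_le (q : ℕ) (t : OnePoint ℝ) (h : (nicf q t).Terminates) :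
    (((nicf q t).toList h).length : ℕ∞) ≤ steps q t := by
  obtain ⟨n, hn⟩ := ENat.ne_top_iff_exists.1 ((nicf_terminates q t).1 h)
  rw [← hn, Stream'.Seq.length_toList]
  exact_mod_cast Nat.find_min' h ((nicf_terminatedAt q n t).2 (steps_le_iff.1 hn.symm.le))

/-! ### Discreteness of the Hecke group -/

/-- The numbers `s_k = sin (k π / q) / sin (π / q)`, the entries of the powers of the elliptic
generator. They satisfy `s_{k+2} = λ_q s_{k+1} - s_k`. -/
noncomputable def sinRatio (q : ℕ) (k : ℤ) : ℝ :=
  Real.sin (k * (Real.pi / q)) / Real.sin (Real.pi / q)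

theorem sinRatio_add_two (q : ℕ) (k : ℤ) :
    sinRatio q (k + 2) = lam q * sinRatio q (k + 1) - sinRatio q k := by
  have := sin_add_angle q ((k + 1 : ℤ) * (Real.pi / q))
  have e1 : ((k + 2 : ℤ) : ℝ) * (Real.pi / q) = (k + 1 : ℤ) * (Real.pi / q) + Real.pi / q := by
    push_cast; ring
  have e2 : (k : ℝ) * (Real.pi / q) = (k + 1 : ℤ) * (Real.pi / q) - Real.pi / q := by
    push_cast; ring
  unfold sinRatio
  rw [e1, e2, this]
  ring

theorem sinRatio_zero (q : ℕ) : sinRatio q 0 = 0 := by simp [sinRatio]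

theorem sinRatio_one {q : ℕ} (hq : 3 ≤ q) : sinRatio q 1 = 1 := by
  simp [sinRatio, (sin_angle_pos hq).ne']

theorem sinRatio_self_sub {q : ℕ} (hq : 3 ≤ q) (k : ℤ) : sinRatio q (q - k) = sinRatio q k := by
  have h : ((q - k : ℤ) : ℝ) * (Real.pi / q) = Real.pi - k * (Real.pi / q) := by
    have : (q : ℝ) ≠ 0 := by positivity
    push_cast
    field_simp
  rw [sinRatio, h, Real.sin_pi_sub, sinRatio]

theorem one_le_sinRatio {q : ℕ} (hq : 3 ≤ q) {k : ℤ} (h1 : 1 ≤ k) (h2 : k < q) :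
    1 ≤ sinRatio q k := by
  have key : ∀ k : ℤ, 1 ≤ k → 2 * k ≤ q → 1 ≤ sinRatio q k := by
    intro k h1 h2
    have ha := angle_bounds hq
    have hpi := Real.pi_pos
    have h1' : (1 : ℝ) ≤ k := by exact_mod_cast h1
    have h2' : (2 : ℝ) * k ≤ q := by exact_mod_cast h2
    have hq0 : (q : ℝ) ≠ 0 := by positivity
    have e : (q : ℝ) * (Real.pi / q) = Real.pi := by field_simp
    rw [sinRatio, one_le_div (sin_angle_pos hq)]
    apply Real.sin_le_sin_of_le_of_le_pi_div_two (by linarith)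
    · have := mul_le_mul_of_nonneg_right h2' ha.1.le
      linarith
    · exact le_mul_of_one_le_left ha.1.le h1'
  rcases le_total (2 * k) q with h | h
  · exact key k h1 h
  · rw [← sinRatio_self_sub hq]
    exact key _ (by omega) (by omega)

/-- The rows of the products of the matrices `A_k = !![s_k, s_{k-1}; s_{k+1}, s_k]` with `1 ≤ k < q`.
Up to sign `A_k` is `U^k σ`, where `U` is the elliptic generator of order `q`, and `A_{q-1}` is the
matrix of `τ_q`. The entries of `A_k` are either `0` or at least `1`, and this is inherited by
products. -/
inductive PosRow (q : ℕ) : ℝ → ℝ → Prop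
  | left : PosRow q 1 0
  | right : PosRow q 0 1
  | mul {x y : ℝ} (k : ℤ) (h1 : 1 ≤ k) (h2 : k < q) (h : PosRow q x y) :
    PosRow q (x * sinRatio q k + y * sinRatio q (k + 1))
      (x * sinRatio q (k - 1) + y * sinRatio q k)

/-- The property of being `0` or at least `1`, which sums and products inherit. -/
def ZeroOrOneLE (x : ℝ) : Prop := x = 0 ∨ 1 ≤ x

theorem ZeroOrOneLE.mul {x y : ℝ} (hx : ZeroOrOneLE x) (hy : ZeroOrOneLE y) :
    ZeroOrOneLE (x * y) := by
  rcases hx with rfl | hx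
  · exact Or.inl (zero_mul _)
  rcases hy with rfl | hy
  · exact Or.inl (mul_zero _)
  · exact Or.inr (one_le_mul_of_one_le_of_one_le hx hy)

theorem ZeroOrOneLE.add {x y : ℝ} (hx : ZeroOrOneLE x) (hy : ZeroOrOneLE y) :
    ZeroOrOneLE (x + y) := by
  rcases hx with rfl | hx
  · rwa [zero_add]
  rcases hy with rfl | hy
  · rw [add_zero]; exact Or.inr hx
  · exact Or.inr (by linarith)

theorem zeroOrOneLE_sinRatio {q : ℕ} (hq : 3 ≤ q) {k : ℤ} (h1 : 0 ≤ k) (h2 : k ≤ q) :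
    ZeroOrOneLE (sinRatio q k) := by
  rcases h1.eq_or_lt with rfl | h1
  · exact Or.inl (sinRatio_zero q)
  rcases h2.eq_or_lt with rfl | h2
  · have := sinRatio_self_sub hq 0
    rw [sub_zero, sinRatio_zero] at this
    exact Or.inl this
  · exact Or.inr (one_le_sinRatio hq h1 h2)

theorem PosRow.zeroOrOneLE {q : ℕ} (hq : 3 ≤ q) {x y : ℝ} (h : PosRow q x y) :
    ZeroOrOneLE x ∧ ZeroOrOneLE y := by
  induction h with
  | left => exact ⟨Or.inr le_rfl, Or.inl rfl⟩
  | right => exact ⟨Or.inl rfl, Or.inr le_rfl⟩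
  | mul k h1 h2 _ ih =>
    have hk := zeroOrOneLE_sinRatio hq (k := k) (by omega) (by omega)
    exact ⟨(ih.1.mul hk).add (ih.2.mul (zeroOrOneLE_sinRatio hq (by omega) (by omega))),
      (ih.1.mul (zeroOrOneLE_sinRatio hq (by omega) (by omega))).add (ih.2.mul hk)⟩

/-- The rows `(c, d)` that are, up to sign, a positive row or a positive row times `σ`. This set is
closed under multiplication from the right by the Hecke group. -/
def HeckeRow (q : ℕ) (c d : ℝ) : Prop :=
  PosRow q c d ∨ PosRow q (-c) (-d) ∨ PosRow q (-d) c ∨ PosRow q d (-c)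

theorem HeckeRow.neg {q : ℕ} {c d : ℝ} (h : HeckeRow q c d) : HeckeRow q (-c) (-d) := by
  unfold HeckeRow at *
  rw [neg_neg, neg_neg]
  tauto

theorem HeckeRow.mul_sigma {q : ℕ} {c d : ℝ} (h : HeckeRow q c d) : HeckeRow q d (-c) := by
  unfold HeckeRow at *
  rw [neg_neg]
  tauto

theorem PosRow.mul_tau {q : ℕ} (hq : 3 ≤ q) {x y : ℝ} (h : PosRow q x y) :
    PosRow q x (x * lam q + y) := by
  have h0 := sinRatio_self_sub hq 0
  have h1 := sinRatio_self_sub hq 1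
  have h2 := sinRatio_self_sub hq 2
  have h3 := sinRatio_add_two q 0
  rw [zero_add, zero_add, sinRatio_zero, sinRatio_one hq] at h3
  rw [sub_zero, sinRatio_zero] at h0
  rw [sinRatio_one hq] at h1
  have := h.mul (q - 1) (by omega) (by omega)
  rw [show (q : ℤ) - 1 - 1 = q - 2 by ring, sub_add_cancel, h0, h1, h2, h3] at this
  convert this using 1 <;> ring

/-- Multiplication by `A_1 = σ⁻¹ τ_q⁻¹ σ`. -/
theorem PosRow.mul_tau_sigma_conj {q : ℕ} (hq : 3 ≤ q) {x y : ℝ} (h : PosRow q x y) :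
    PosRow q (x + y * lam q) y := by
  have h3 := sinRatio_add_two q 0
  rw [zero_add, zero_add, sinRatio_zero, sinRatio_one hq] at h3
  have := h.mul 1 le_rfl (by omega)
  rw [sub_self, sinRatio_zero, sinRatio_one hq, one_add_one_eq_two, h3] at this
  convert this using 1 <;> ring

/-- Since `A_k τ_q⁻¹` is `A_{k+1} σ` up to sign, or up to sign the identity if `k = q - 1`. -/
theorem PosRow.mul_tau_inv {q : ℕ} (hq : 3 ≤ q) {x y : ℝ} (h : PosRow q x y) :
    HeckeRow q x (y - x * lam q) := by
  cases h with
  | left =>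
    have := (PosRow.right (q := q)).mul_tau_sigma_conj hq
    exact Or.inr (Or.inr (Or.inl (by convert this using 1; ring)))
  | right => exact Or.inl (by convert PosRow.right (q := q) using 1; ring)
  | @mul x y k h1 h2 h =>
    have e1 := sinRatio_add_two q (k - 1)
    rw [show k - 1 + 2 = k + 1 by ring, sub_add_cancel] at e1
    have e2 := sinRatio_add_two q k
    rcases (show k + 1 ≤ q by omega).eq_or_lt with hk | hk
    · have e3 := sinRatio_self_sub hq 0
      rw [sub_zero, sinRatio_zero] at e3
      have e4 := sinRatio_self_sub hq 1
      rw [sinRatio_one hq, ← hk, add_sub_cancel_right] at e4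
      have e5 : sinRatio q (k + 1) = 0 := by rw [hk, e3]
      rw [e5, e4] at e1
      left
      rw [e4, e5]
      convert h using 1
      · ring
      · rw [show sinRatio q (k - 1) = lam q by linarith]; ring
    · have := h.mul (k + 1) (by omega) hk
      right; right; left
      rw [add_sub_cancel_right, show k + 1 + 1 = k + 2 by ring] at this
      convert this using 1
      rw [e2, show sinRatio q (k - 1) = lam q * sinRatio q k - sinRatio q (k + 1) by linarith]
      ring

/-- Since `A_k σ τ_q` is `A_{k-1}` up to sign, or `σ` up to sign if `k = 1`. -/
theorem PosRow.sigma_mul_tau {q : ℕ} (hq : 3 ≤ q) {x y : ℝ} (h : PosRow q x y) :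
    HeckeRow q y (y * lam q - x) := by
  cases h with
  | left => exact Or.inr (Or.inl (by convert PosRow.right (q := q) using 1 <;> ring))
  | right =>
    have := (PosRow.left (q := q)).mul_tau hq
    exact Or.inl (by convert this using 1; ring)
  | @mul x y k h1 h2 h =>
    have e1 := sinRatio_add_two q (k - 1)
    rw [show k - 1 + 2 = k + 1 by ring, sub_add_cancel] at e1
    have e2 := sinRatio_add_two q (k - 2)
    rw [show k - 2 + 1 = k - 1 by ring, sub_add_cancel] at e2
    rcases h1.eq_or_lt with hk | hk
    · rw [← hk, sub_self, sinRatio_zero, sinRatio_one hq] at e1 ⊢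
      right; right; left
      convert h using 1
      · rw [e1]; ring
      · ring
    · have := h.mul (k - 1) (by omega) (by omega)
      left
      rw [sub_add_cancel, show k - 1 - 1 = k - 2 by ring] at this
      convert this using 1
      rw [e1, show sinRatio q (k - 2) = lam q * sinRatio q (k - 1) - sinRatio q k by linarith]
      ring

theorem HeckeRow.mul_tau {q : ℕ} (hq : 3 ≤ q) {c d : ℝ} (h : HeckeRow q c d) :
    HeckeRow q c (c * lam q + d) := by
  rcases h with h | h | h | h
  · exact Or.inl (h.mul_tau hq)
  · exact Or.inr (Or.inl (by convert h.mul_tau hq using 1; ring))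
  · convert h.sigma_mul_tau hq using 1; ring
  · convert (h.sigma_mul_tau hq).neg using 1 <;> ring

theorem HeckeRow.mul_tau_inv {q : ℕ} (hq : 3 ≤ q) {c d : ℝ} (h : HeckeRow q c d) :
    HeckeRow q c (d - c * lam q) := by
  rcases h with h | h | h | h
  · exact h.mul_tau_inv hq
  · convert (h.mul_tau_inv hq).neg using 1 <;> ring
  · exact Or.inr (Or.inr (Or.inl (by convert h.mul_tau_sigma_conj hq using 1; ring)))
  · exact Or.inr (Or.inr (Or.inr (by convert h.mul_tau_sigma_conj hq using 1; ring)))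

theorem det_of_mem {q : ℕ} {g : GL (Fin 2) ℝ} (hg : g ∈ heckeGroup q) :
    g 0 0 * g 1 1 - g 0 1 * g 1 0 = 1 := by
  have : heckeGroup q ≤ (Matrix.GeneralLinearGroup.det : GL (Fin 2) ℝ →* ℝˣ).ker := by
    rw [heckeGroup, Subgroup.closure_le]
    rintro g (rfl | rfl) <;> rw [SetLike.mem_coe, MonoidHom.mem_ker] <;> ext <;>
      simp [sigma, tau, Matrix.GeneralLinearGroup.mkOfDetNeZero]
  have h := congrArg Units.val (this hg)
  rw [Matrix.GeneralLinearGroup.val_det_apply, Matrix.det_fin_two] at h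
  exact h

theorem val_inv_of_mem {q : ℕ} {g : GL (Fin 2) ℝ} (hg : g ∈ heckeGroup q) :
    (g⁻¹).val = !![g 1 1, -g 0 1; -g 1 0, g 0 0] := by
  have h := det_of_mem hg
  rw [Matrix.coe_units_inv, Matrix.inv_def, Matrix.det_fin_two, h, Matrix.adjugate_fin_two]
  simp

theorem heckeRow_of_mem {q : ℕ} (hq : 3 ≤ q) {g : GL (Fin 2) ℝ} (hg : g ∈ heckeGroup q) :
    HeckeRow q (g 1 0) (g 1 1) := by
  induction hg using Subgroup.closure_induction_right with
  | one => exact Or.inl (by simpa using PosRow.right)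
  | mul_right g _ s hs ih =>
    rcases hs with rfl | rfl
    · have := ih.mul_sigma
      simpa [Matrix.mul_apply, sigma, Matrix.GeneralLinearGroup.mkOfDetNeZero] using this
    · have := ih.mul_tau hq
      simpa [Matrix.mul_apply, tau, Matrix.GeneralLinearGroup.mkOfDetNeZero] using this
  | mul_inv_cancel g _ s hs ih =>
    rcases hs with rfl | rfl
    · have := ih.mul_sigma.neg
      rw [Units.val_mul, val_inv_of_mem (sigma_mem q)]
      simpa [Matrix.mul_apply, sigma, Matrix.GeneralLinearGroup.mkOfDetNeZero] using this
    · have := ih.mul_tau_inv hq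
      rw [Units.val_mul, val_inv_of_mem (tau_mem q)]
      simpa [Matrix.mul_apply, tau, Matrix.GeneralLinearGroup.mkOfDetNeZero, sub_eq_neg_add] using this

/-- The entries of the bottom row of an element of the Hecke group avoid `(-1, 0) ∪ (0, 1)`. -/
theorem one_le_abs_of_mem {q : ℕ} (hq : 3 ≤ q) {g : GL (Fin 2) ℝ} (hg : g ∈ heckeGroup q) :
    (g 1 0 = 0 ∨ 1 ≤ |g 1 0|) ∧ (g 1 1 = 0 ∨ 1 ≤ |g 1 1|) := by
  have key : ∀ x : ℝ, ZeroOrOneLE x → x = 0 ∨ 1 ≤ |x| := fun x hx =>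
    hx.imp_right fun h => h.trans (le_abs_self x)
  have key' : ∀ x : ℝ, ZeroOrOneLE (-x) → x = 0 ∨ 1 ≤ |x| := fun x hx => by
    simpa using key _ hx
  rcases heckeRow_of_mem hq hg with h | h | h | h
  · exact ⟨key _ (h.zeroOrOneLE hq).1, key _ (h.zeroOrOneLE hq).2⟩
  · exact ⟨key' _ (h.zeroOrOneLE hq).1, key' _ (h.zeroOrOneLE hq).2⟩
  · exact ⟨key _ (h.zeroOrOneLE hq).2, key' _ (h.zeroOrOneLE hq).1⟩
  · exact ⟨key' _ (h.zeroOrOneLE hq).2, key _ (h.zeroOrOneLE hq).1⟩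

theorem abs_of_apply_eq_zero {q : ℕ} (hq : 3 ≤ q) {g : GL (Fin 2) ℝ} (hg : g ∈ heckeGroup q)
    (h : g 1 0 = 0) : g 0 0 = g 1 1 ∧ |g 0 0| = 1 := by
  have hd := det_of_mem hg
  rw [h, mul_zero, sub_zero] at hd
  have h1 := (one_le_abs_of_mem hq hg).2
  have h2 := (one_le_abs_of_mem hq (inv_mem hg)).2
  rw [val_inv_of_mem hg] at h2
  have h2 : g 0 0 = 0 ∨ 1 ≤ |g 0 0| := h2
  have h1 := h1.resolve_left (right_ne_zero_of_mul_eq_one hd)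
  have h2 := h2.resolve_left (left_ne_zero_of_mul_eq_one hd)
  have hd' : |g 0 0| * |g 1 1| = 1 := by rw [← abs_mul, hd, abs_one]
  have h3 : |g 0 0| = 1 := by nlinarith
  refine ⟨?_, h3⟩
  have h4 : g 0 0 * g 0 0 = 1 := by rw [← abs_mul_abs_self, h3, one_mul]
  exact mul_left_cancel₀ (left_ne_zero_of_mul_eq_one hd) (h4.trans hd.symm)

theorem smul_infty_eq_infty_iff (g : GL (Fin 2) ℝ) : g • (∞ : OnePoint ℝ) = ∞ ↔ g 1 0 = 0 := by
  rw [OnePoint.smul_infty_eq_ite]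
  split_ifs with h <;> simp [h]

/-- The stabilizer of `∞` acts by translations by multiples of `λ_q`, and so preserves the step
count. -/
theorem steps_smul_of_smul_infty {q : ℕ} (hq : 3 ≤ q) {g : GL (Fin 2) ℝ} (hg : g ∈ heckeGroup q)
    (h : g • (∞ : OnePoint ℝ) = ∞) (t : OnePoint ℝ) : steps q (g • t) = steps q t := by
  have h10 := (smul_infty_eq_infty_iff g).1 h
  obtain ⟨h11, habs⟩ := abs_of_apply_eq_zero hq hg h10
  have h0 : g 0 0 ≠ 0 := fun h0 => by rw [h0, abs_zero] at habs; exact zero_ne_one habs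
  set k := nearest q (g 0 1 / g 0 0) with hk
  obtain ⟨hk1, hk2⟩ := (nearest_eq_iff hq).1 hk.symm
  have hl := lam_lt_two hq
  have hβ : g 0 1 / g 0 0 = k * lam q := by
    -- After `g` is reduced to a translation by less than `1`, this translation length is the
    -- absolute value of an entry of a bottom row, so it vanishes.
    have hmem := mul_mem (sigma_mem q) (mul_mem hg (rosenMap_mem q (-k)))
    have hrow : (sigma * (g * rosenMap q (-k))) 1 0 = g 0 0 * (-k * lam q + g 0 1 / g 0 0) := by
      simp [Matrix.mul_apply, sigma, rosenMap, Matrix.GeneralLinearGroup.mkOfDetNeZero]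
      field_simp
    have hd := (one_le_abs_of_mem hq hmem).1
    rw [hrow, abs_mul, habs, one_mul] at hd
    have hlt : |-k * lam q + g 0 1 / g 0 0| < 1 := abs_lt.2 ⟨by linarith, by linarith⟩
    have := (mul_eq_zero.1 (hd.resolve_right (not_le.2 hlt))).resolve_left h0
    linarith
  induction t using OnePoint.rec with
  | infty => rw [h]
  | coe x =>
    rw [← steps_add_lam hq x k, ← hβ, OnePoint.smul_some_eq_ite, h10, zero_mul, zero_add,
      ← h11, if_neg h0]
    congr 2
    field_simp

/-! ### Convergence -/

/-- If `a / c` is the `m`-th convergent of `y`, then `|a - c y|` is the product of the numbers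
`|b_{k+1} λ_q - t_k|` for `k < m`, each of which is at most `λ_q / 2 < 1`. -/
theorem abs_convergent_le {q : ℕ} (hq : 3 ≤ q) (m : ℕ) {y : ℝ}
    (hy : (gaussStep q)^[m] (y : OnePoint ℝ) ≠ ∞) :
    |cfMatrix q ((nicf q y).take m) 0 0 - cfMatrix q ((nicf q y).take m) 1 0 * y|
      ≤ (lam q / 2) ^ m := by
  induction m generalizing y with
  | zero => simp
  | succ m ih =>
    rw [Function.iterate_succ_apply] at hy
    obtain ⟨h1, h2⟩ := (nearest_eq_iff hq).1 (rfl : nearest q y = nearest q y)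
    have h0 : nearest q y * lam q - y ≠ 0 := fun h0 => by
      rw [gaussStep_of_eq_zero rfl h0, iterate_gaussStep_infty] at hy
      exact hy rfl
    rw [cfMatrix_take_succ]
    rw [gaussStep_of_eq rfl h0] at hy ⊢
    have ih := ih hy
    set M := cfMatrix q ((nicf q ((1 / (nearest q y * lam q - y) : ℝ) : OnePoint ℝ)).take m)
    have e : (rosenMap q (nearest q y) * M) 0 0 - (rosenMap q (nearest q y) * M) 1 0 * y =
        (nearest q y * lam q - y) * (M 0 0 - M 1 0 * (1 / (nearest q y * lam q - y))) := by
      simp [Matrix.mul_apply, rosenMap, Matrix.GeneralLinearGroup.mkOfDetNeZero]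
      field_simp
      ring
    rw [e, abs_mul, pow_succ']
    exact mul_le_mul (abs_le.2 ⟨h1, h2.le⟩) ih (abs_nonneg _) (by linarith [lam_pos hq])

theorem lam_half_pow_lt_one {q : ℕ} (hq : 3 ≤ q) {m : ℕ} (hm : 1 ≤ m) : (lam q / 2) ^ m < 1 :=
  pow_lt_one₀ (by linarith [lam_pos hq]) (by linarith [lam_lt_two hq]) (by omega)

/-- Discreteness bounds the denominators of the convergents from below, so the estimate of
`abs_convergent_le` gives geometric convergence. -/
theorem exists_convergent_eq {q : ℕ} (hq : 3 ≤ q) {m : ℕ} (hm : 1 ≤ m) {y : ℝ}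
    (hy : steps q y = ⊤) :
    ∃ v : ℝ, convergent q (nicf q y) m = v ∧ |v - y| ≤ (lam q / 2) ^ m := by
  have h := abs_convergent_le hq m (y := y) fun h => by
    have := steps_le_iff.2 h
    rw [hy] at this
    exact ENat.natCast_ne_top m (top_le_iff.1 this)
  have hmem := cfMatrix_mem q ((nicf q y).take m)
  rw [convergent, value_eq_smul]
  set M := cfMatrix q ((nicf q y).take m)
  have h0 : M 1 0 ≠ 0 := fun h0 => by
    have h1 := (abs_of_apply_eq_zero hq hmem h0).2
    rw [h0, zero_mul, sub_zero, h1] at h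
    exact absurd h (not_le.2 (lam_half_pow_lt_one hq hm))
  have h1 := (one_le_abs_of_mem hq hmem).1.resolve_left h0
  refine ⟨M 0 0 / M 1 0, by rw [OnePoint.smul_infty_eq_ite, if_neg h0], ?_⟩
  have e : M 0 0 / M 1 0 - y = (M 0 0 - M 1 0 * y) / M 1 0 := by field_simp
  rw [e, abs_div]
  exact (div_le_self (abs_nonneg _) h1).trans h

theorem tendsto_convergent {q : ℕ} (hq : 3 ≤ q) {y : ℝ} (hy : steps q y = ⊤) :
    Tendsto (convergent q (nicf q y)) atTop (𝓝 (y : OnePoint ℝ)) := by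
  choose! v hv1 hv2 using fun (m : ℕ) (hm : 1 ≤ m) => exists_convergent_eq hq hm hy
  have hv : Tendsto v atTop (𝓝 y) := by
    rw [tendsto_iff_dist_tendsto_zero]
    refine squeeze_zero' (Eventually.of_forall fun _ => dist_nonneg) ?_
      (tendsto_pow_atTop_nhds_zero_of_lt_one (r := lam q / 2) (by linarith [lam_pos hq])
        (by linarith [lam_lt_two hq]))
    filter_upwards [eventually_ge_atTop 1] with m hm using hv2 m hm
  refine Tendsto.congr' ?_ ((OnePoint.continuous_coe.tendsto y).comp hv)
  filter_upwards [eventually_ge_atTop 1] with m hm using (hv1 m hm).symm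

/-- The vertices of the Farey graph are dense. -/
theorem exists_steps_ne_top {q : ℕ} (hq : 3 ≤ q) {u v : ℝ} (huv : u < v) :
    ∃ x ∈ Set.Ioo u v, steps q x ≠ ⊤ := by
  obtain ⟨w, hw⟩ := exists_between huv
  by_cases h : steps q w = ⊤
  · have h1 := (tendsto_convergent hq h).eventually
      (OnePoint.isOpenEmbedding_coe.image_mem_nhds.2 (Ioo_mem_nhds hw.1 hw.2))
    obtain ⟨m, x, hx, hxm⟩ := h1.exists
    refine ⟨x, hx, ?_⟩
    rw [hxm]
    exact ne_top_of_le_ne_top (ENat.natCast_ne_top _) (steps_value_le hq _)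
  · exact ⟨w, hw, h⟩

/-! ### Infinite geodesics -/

/-- The points just to the left of `y` have the same first `m` coefficients as `y`. The choice of
the side makes ties harmless: `nearest` is constant on intervals that are open on the left, and the
maps `x ↦ 1 / (b λ_q - x)` are increasing. -/
theorem eventually_steps_eq {q : ℕ} (hq : 3 ≤ q) (m : ℕ) {y : ℝ}
    (hy : (gaussStep q)^[m] (y : OnePoint ℝ) ≠ ∞) :
    ∀ᶠ x : ℝ in 𝓝[<] y,
      steps q x = steps q ((cfMatrix q ((nicf q y).take m))⁻¹ • (x : OnePoint ℝ)) + m := by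
  induction m generalizing y with
  | zero => simp
  | succ m ih =>
    rw [Function.iterate_succ_apply] at hy
    obtain ⟨h1, h2⟩ := (nearest_eq_iff hq).1 (rfl : nearest q y = nearest q y)
    have h0 : nearest q y * lam q - y ≠ 0 := fun h0 => by
      rw [gaussStep_of_eq_zero rfl h0, iterate_gaussStep_infty] at hy
      exact hy rfl
    rw [cfMatrix_take_succ]
    rw [gaussStep_of_eq rfl h0] at hy ⊢
    have ih := ih hy
    set b := nearest q y
    have hcont : ContinuousAt (fun x : ℝ => b * lam q - x) y := by fun_prop
    have hlt : ∀ᶠ x : ℝ in 𝓝[<] y, x < y := eventually_mem_nhdsWithin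
    have hb : ∀ᶠ x : ℝ in 𝓝[<] y, b * lam q - x < lam q / 2 :=
      (hcont.eventually_lt_const h2).filter_mono nhdsWithin_le_nhds
    have hsign : ∀ᶠ x : ℝ in 𝓝[<] y, 0 < (b * lam q - x) * (b * lam q - y) :=
      ((hcont.mul_const _).eventually_const_lt (mul_self_pos.2 h0)).filter_mono nhdsWithin_le_nhds
    have htend : Tendsto (fun x : ℝ => 1 / (b * lam q - x)) (𝓝[<] y)
        (𝓝[<] (1 / (b * lam q - y))) := by
      refine tendsto_nhdsWithin_iff.2 ⟨?_, ?_⟩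
      · exact (tendsto_const_nhds.div hcont h0).mono_left nhdsWithin_le_nhds
      · filter_upwards [hlt, hsign] with x hx hs
        have hx0 : b * lam q - x ≠ 0 := left_ne_zero_of_mul hs.ne'
        rw [Set.mem_Iio, ← sub_pos]
        have : 1 / (b * lam q - y) - 1 / (b * lam q - x)
            = (y - x) / ((b * lam q - x) * (b * lam q - y)) := by
          field_simp
          ring
        rw [this]
        exact div_pos (sub_pos.2 hx) hs
    filter_upwards [hlt, hb, hsign, htend.eventually ih] with x hx hbx hs hih
    have hx0 : b * lam q - x ≠ 0 := left_ne_zero_of_mul hs.ne'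
    have hn : nearest q x = b := (nearest_eq_iff hq).2 ⟨by linarith, hbx⟩
    have hg := gaussStep_of_eq hn hx0
    have hg' : gaussStep q x = (rosenMap q b)⁻¹ • (x : OnePoint ℝ) := by rw [← hn]; rfl
    rw [steps_coe, hg, hih, ← hg, hg', mul_inv_rev, mul_smul, add_assoc, Nat.cast_add_one]

/-- A vertex `x` close to `y` on the left has step count `m` plus that of `S⁻¹ x`, where `S` is the
matrix of the first `m` coefficients. If `l` has the same value as these, its matrix differs from
`S` by an element of the stabilizer of `∞`, so `x` has at most
`l.length` steps more than `S⁻¹ x`. -/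
theorem isGeodesicFinite_take {q : ℕ} (hq : 3 ≤ q) (m : ℕ) {y : ℝ} (hy : steps q y = ⊤) :
    IsGeodesicFinite q ((nicf q y).take m) := by
  intro l hl
  refine Stream'.Seq.length_take_le.trans ?_
  have hev := eventually_steps_eq hq m (y := y) fun h => by
    have := steps_le_iff.2 h
    rw [hy] at this
    exact ENat.natCast_ne_top m (top_le_iff.1 this)
  obtain ⟨z, hz, hzy⟩ := mem_nhdsLT_iff_exists_Ioo_subset.1 hev
  obtain ⟨x, hx, hxt⟩ := exists_steps_ne_top hq hz
  have hx1 : steps q x = _ := hzy hx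
  set S := cfMatrix q ((nicf q y).take m)
  set t := S⁻¹ • (x : OnePoint ℝ)
  have hstab := steps_smul_of_smul_infty hq (g := (cfMatrix q l)⁻¹ * S)
    (mul_mem (inv_mem (cfMatrix_mem q l)) (cfMatrix_mem q _))
    (by rw [mul_smul, inv_smul_eq_iff, ← value_eq_smul, ← value_eq_smul, hl]) t
  have hx2 := steps_cfMatrix_smul_le hq l (((cfMatrix q l)⁻¹ * S) • t)
  rw [hstab, mul_smul, smul_inv_smul, smul_inv_smul, hx1] at hx2
  have ht : steps q t ≠ ⊤ := fun ht => hxt (by rw [hx1, ht, top_add])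
  exact_mod_cast (ENat.add_le_add_iff_left ht).1 hx2

end Rosen

theorem theorem1 (q : ℕ) (hq : 3 ≤ q) (y : ℝ) :
    ((Rosen.nearestIntegerCF q y).Terminates ↔ (y : OnePoint ℝ) ∈ Rosen.fareyVertices q) ∧
      Rosen.IsExpansion q (Rosen.nearestIntegerCF q y) (y : OnePoint ℝ) ∧
      Rosen.IsGeodesic q (Rosen.nearestIntegerCF q y) := by
  have hcf : Rosen.nearestIntegerCF q y = Rosen.nicf q y := rfl
  have htop : ¬ (Rosen.nicf q y).Terminates → Rosen.steps q y = ⊤ := fun h =>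
    not_not.1 (mt (Rosen.nicf_terminates q y).2 h)
  rw [hcf]
  refine ⟨⟨fun h => ?_, ?_⟩, ⟨Rosen.value_toList_nicf q y, fun h => ?_⟩, fun h l hl => ?_,
    fun h m _ => Rosen.isGeodesicFinite_take hq m (htop h)⟩
  · rw [← Rosen.value_toList_nicf q y h, Rosen.value_eq_smul]
    exact ⟨⟨_, Rosen.cfMatrix_mem q _⟩, rfl⟩
  · rintro ⟨⟨g, hg⟩, hgy⟩
    have hgy : g • (∞ : OnePoint ℝ) = y := hgy
    rw [Rosen.nicf_terminates, ← hgy, Rosen.steps_smul_ne_top hq hg, Rosen.steps_infty]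
    exact ENat.zero_ne_top
  · exact Rosen.tendsto_convergent hq (htop h)
  · have h1 := Rosen.steps_value_le hq l
    rw [hl, Rosen.value_toList_nicf] at h1
    exact_mod_cast (Rosen.length_toList_nicf_le q y h).trans h1
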